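/- All codes are binary. Let $C\subseteq\mathbb F_2^{90}$ be a self-dual $[90,45,16]$ code (a $45$-dimensional subspace with $C=C^\perp$ and minimum weight $16$); it is extremal, i.e. it meets Rains's bound $d\le 4\lfloor 90/24\rfloor+4=16$. Suppose that $C$ is singly even, i.e. some codeword has weight $\equiv 2\pmod 4$. Let $C_0$ be the subcode of codewords of weight $\equiv 0 \pmod 4$, and let $S=C_0^\perp\setminus C$ be the shadow of $C$. For integers $\alpha,\beta$ let $W_{90}=W_{90}(\alpha,\beta)$ be the polynomial $$W_{90}=\sum_{j=0}^{9}a_j\,(1+y^2)^{45-4j}\bigl(y^2(1-y^2)^2\bigr)^j,$$ $$(a_0,\dots,a_9)=(1,-45,765,-6180,24750,-47619,40665,-14040,8\beta,-512\alpha),$$ so that $W_{90}=1+(9180+8\beta)y^{16}+(-512\alpha-24\beta+224360)y^{18}+\cdots$; this is the family of possible weight enumerators of an extremal singly even self-dual $[90,45,16]$ code whose shadow has minimum weight at least $9$. If $C$ has weight enumerator $W_{90}(\alpha,\beta)$ for some integers $\alpha,\beta$, then $\alpha$ is the number of vectors of weight $9$ in $S$, and $0\le\alpha\le 76$. -/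

import Mathlib

/-- The dual of a set `s` of binary vectors of length `n`:
all `x` with `x ⬝ᵥ y = 0` for every `y ∈ s`. -/
def dualCode {n : ℕ} (s : Set (Fin n → ZMod 2)) : Submodule (ZMod 2) (Fin n → ZMod 2) where
  carrier := {x | ∀ y ∈ s, x ⬝ᵥ y = 0}
  add_mem' := fun ha hb y hy => by rw [add_dotProduct, ha y hy, hb y hy, add_zero]
  zero_mem' := fun y _ => zero_dotProduct y
  smul_mem' := fun c x hx y hy => by rw [smul_dotProduct, hx y hy, smul_zero]

/-- A code is self-dual if it equals its dual. -/
def IsSelfDual {n : ℕ} (C : Submodule (ZMod 2) (Fin n → ZMod 2)) : Prop :=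
  C = dualCode (C : Set (Fin n → ZMod 2))

/-- Some codeword has weight congruent to `2` modulo `4`. -/
def IsSinglyEven {n : ℕ} (C : Submodule (ZMod 2) (Fin n → ZMod 2)) : Prop :=
  ∃ x ∈ C, hammingNorm x ≡ 2 [MOD 4]

/-- The minimum non-zero weight of the codewords of `C`
(with value `0` for the zero code). -/
noncomputable def minWeight {n : ℕ} (C : Submodule (ZMod 2) (Fin n → ZMod 2)) : ℕ :=
  sInf {w | ∃ x ∈ C, x ≠ 0 ∧ hammingNorm x = w}

/-- `C` is an `[n, k, d]` code. -/
def IsCode (n k d : ℕ) (C : Submodule (ZMod 2) (Fin n → ZMod 2)) : Prop :=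
  Module.finrank (ZMod 2) C = k ∧ minWeight C = d

open Classical in
/-- Rains's upper bound for the minimum weight of a self-dual code `C` of length `n`. -/
noncomputable def rainsBound {n : ℕ} (C : Submodule (ZMod 2) (Fin n → ZMod 2)) : ℕ :=
  if n % 24 = 22 then 4 * (n / 24) + 6
  else if n % 24 = 0 ∧ IsSinglyEven C then 4 * (n / 24) + 2
  else 4 * (n / 24) + 4

/-- A self-dual code is extremal if its minimum weight meets Rains's bound. -/
def IsExtremal {n : ℕ} (C : Submodule (ZMod 2) (Fin n → ZMod 2)) : Prop :=
  IsSelfDual C ∧ minWeight C = rainsBound C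

/-- `C₀`, the codewords of weight divisible by `4`. -/
def doublyEvenPart {n : ℕ} (C : Submodule (ZMod 2) (Fin n → ZMod 2)) : Set (Fin n → ZMod 2) :=
  {x | x ∈ C ∧ hammingNorm x ≡ 0 [MOD 4]}

/-- The shadow `C₀^⊥ \ C` of `C`. -/
def shadow {n : ℕ} (C : Submodule (ZMod 2) (Fin n → ZMod 2)) : Set (Fin n → ZMod 2) :=
  (dualCode (doublyEvenPart C) : Set (Fin n → ZMod 2)) \ (C : Set (Fin n → ZMod 2))

/-- The number of vectors of weight `i` in `s`. -/
noncomputable def weightCount {n : ℕ} (s : Set (Fin n → ZMod 2)) (i : ℕ) : ℕ :=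
  {x | x ∈ s ∧ hammingNorm x = i}.ncard

/-- The weight enumerator `∑ A_i y^i` of a set of binary vectors. -/
noncomputable def weightEnumerator {n : ℕ} (s : Set (Fin n → ZMod 2)) : Polynomial ℤ :=
  ∑ i ∈ Finset.range (n + 1), Polynomial.C (weightCount s i : ℤ) * Polynomial.X ^ i

open Polynomial in
/-- The two-parameter weight enumerator
`W_90 = 1 + (9180 + 8 β) y^16 + (-512 α - 24 β + 224360) y^18 + ⋯`, written out in full.
It is the polynomial `∑_{j ≤ 9} a_j (1 + y^2)^(45 - 4 j) (y^2 (1 - y^2)^2)^j` with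
`(a_0, …, a_9) = (1, -45, 765, -6180, 24750, -47619, 40665, -14040, 8 β, -512 α)`. -/
noncomputable def W90 (α β : ℤ) : ℤ[X] :=
  (1 + X ^ 90)
    + C (9180 + 8 * β) * (X ^ 16 + X ^ 74)
    + C (224360 - 512 * α - 24 * β) * (X ^ 18 + X ^ 72)
    + C (2931264 + 4608 * α - 80 * β) * (X ^ 20 + X ^ 70)
    + C (30225600 - 13824 * α + 304 * β) * (X ^ 22 + X ^ 68)
    + C (249889800 + 1536 * α + 312 * β) * (X ^ 24 + X ^ 66)
    + C (1650702465 + 82944 * α - 1768 * β) * (X ^ 26 + X ^ 64)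
    + C (8802420480 - 156672 * α - 416 * β) * (X ^ 28 + X ^ 62)
    + C (38262109440 - 82944 * α + 6240 * β) * (X ^ 30 + X ^ 60)
    + C (136543220550 + 599040 * α - 1144 * β) * (X ^ 32 + X ^ 58)
    + C (402332571000 - 456192 * α - 14872 * β) * (X ^ 34 + X ^ 56)
    + C (983474367040 - 875008 * α + 6864 * β) * (X ^ 36 + X ^ 54)
    + C (2001918156480 + 1654272 * α + 25168 * β) * (X ^ 38 + X ^ 52)
    + C (3403267934616 + 78336 * α - 17160 * β) * (X ^ 40 + X ^ 50)
    + C (4842050724060 - 2402304 * α - 30888 * β) * (X ^ 42 + X ^ 48)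
    + C (5773600558080 + 1566720 * α + 27456 * β) * (X ^ 44 + X ^ 46)

/-! The value of `α` comes from the MacWilliams identity for `C₀`: the enumerator of `C₀` is the
part of `W90` in exponents divisible by 4. Its Krawtchouk transform in degree 9 is `2 ^ 44 * α` with
`|C₀| = 2 ^ 44`, so `C₀^⊥` has `α` vectors of weight 9, none of them in `C`
(`weightCount_shadow_eq`). In particular `α ≥ 0`.

For the upper bound, two shadow vectors of weight 9 add up to a codeword of weight `18 - 2t`, where
`t` is the size of the intersection of their supports. Minimum weight 16 forces `t ≤ 1`, and the sum
lies in `C₀` exactly when `t = 1`. The supports thus split into two families of 9-sets, meeting in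
one point within a family and disjoint across (`weightCount_shadow_le`). By `card_le_or` each family
has at most 73 members. By `two_families`, a least-squares inequality for point degrees, sizes `m`
and `l` satisfy `(m - 1) * (l - 1) ≤ 81` when both are positive. Together these exclude `m + l ≥ 77`
(`card_add_card_le_of_isOneIntersecting`). -/

/-- The number of members of `F` that contain `p`. -/
def blockDegree {V : Type*} [DecidableEq V] (F : Finset (Finset V)) (p : V) : ℕ :=
  (F.filter (p ∈ ·)).card

/-! ### Families of sets with prescribed intersections. -/

section BlockDegree

variable {V : Type*} [DecidableEq V]

theorem sum_blockDegree (F : Finset (Finset V)) (s : Finset V) :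
    ∑ p ∈ s, blockDegree F p = ∑ A ∈ F, (s ∩ A).card := by
  simp only [blockDegree, Finset.card_filter]
  rw [Finset.sum_comm]
  refine Finset.sum_congr rfl fun A _ => ?_
  rw [← Finset.card_filter, Finset.filter_mem_eq_inter]

/-- Double counting of the triples `(p, A, B)` with `p ∈ A ∩ B`. -/
theorem sum_blockDegree_mul [Fintype V] (F G : Finset (Finset V)) :
    ∑ p, blockDegree F p * blockDegree G p = ∑ A ∈ F, ∑ B ∈ G, (A ∩ B).card := by
  have h (p : V) : blockDegree F p * blockDegree G p =
      ∑ A ∈ F, if p ∈ A then blockDegree G p else 0 := by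
    rw [blockDegree, Finset.card_filter, Finset.sum_mul]
    simp
  simp only [h]
  rw [Finset.sum_comm]
  refine Finset.sum_congr rfl fun A _ => ?_
  rw [← sum_blockDegree, Finset.sum_ite_mem, Finset.univ_inter]

/-- A family of `k`-sets any two of which meet in exactly one point. -/
structure IsOneIntersecting (k : ℕ) (F : Finset (Finset V)) : Prop where
  card_eq : ∀ A ∈ F, A.card = k
  card_inter : ∀ A ∈ F, ∀ B ∈ F, A ≠ B → (A ∩ B).card = 1

namespace IsOneIntersecting

variable {k : ℕ} {F : Finset (Finset V)}

theorem sum_card_inter (hF : IsOneIntersecting k F) {A : Finset V} (hA : A ∈ F) :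
    ∑ B ∈ F, (A ∩ B).card + 1 = F.card + k := by
  rw [← Finset.add_sum_erase F _ hA, Finset.inter_self, hF.card_eq A hA,
    Finset.sum_congr rfl fun B hB => hF.card_inter A hA B (Finset.mem_of_mem_erase hB)
      (Finset.ne_of_mem_erase hB).symm, ← Finset.card_eq_sum_ones]
  have := Finset.card_erase_add_one hA
  omega

theorem sum_blockDegree_univ [Fintype V] (hF : IsOneIntersecting k F) :
    ∑ p, blockDegree F p = F.card * k := by
  rw [sum_blockDegree, Finset.sum_congr rfl fun A hA => by
    rw [Finset.univ_inter, hF.card_eq A hA], Finset.sum_const, smul_eq_mul]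

theorem sum_blockDegree_sq [Fintype V] (hF : IsOneIntersecting k F) :
    ∑ p, blockDegree F p * blockDegree F p + F.card = F.card * (F.card + k) := by
  rw [sum_blockDegree_mul]
  conv_lhs => rw [Finset.card_eq_sum_ones F, ← Finset.sum_add_distrib]
  rw [Finset.sum_congr rfl fun A hA => hF.sum_card_inter hA, Finset.sum_const, smul_eq_mul]

/-- The members through `p` meet a member that misses `p` in distinct points. -/
theorem blockDegree_le (hF : IsOneIntersecting k F) {p : V} {A : Finset V} (hA : A ∈ F)
    (hp : p ∉ A) : blockDegree F p ≤ k := by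
  rw [← hF.card_eq A hA, blockDegree]
  have hex : ∀ B ∈ F.filter (p ∈ ·), ∃ q, q ∈ A ∧ q ∈ B := by
    intro B hB
    rw [Finset.mem_filter] at hB
    have h1 := hF.card_inter A hA B hB.1 (by rintro rfl; exact hp hB.2)
    obtain ⟨q, hq⟩ := Finset.card_pos.1 (by omega : 0 < (A ∩ B).card)
    exact ⟨q, Finset.mem_inter.1 hq⟩
  have : Nonempty V := ⟨p⟩
  choose! f hfA hfB using hex
  refine Finset.card_le_card_of_injOn f (fun B hB => hfA B hB) ?_
  intro B hB B' hB' he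
  by_contra hne
  have hB2 := Finset.mem_filter.1 (Finset.mem_coe.1 hB)
  have hB2' := Finset.mem_filter.1 (Finset.mem_coe.1 hB')
  have h1 := hF.card_inter B hB2.1 B' hB2'.1 hne
  have hpq := Finset.card_le_one.1 h1.le p (Finset.mem_inter.2 ⟨hB2.2, hB2'.2⟩) (f B)
    (Finset.mem_inter.2 ⟨hfB B hB, he ▸ hfB B' hB'⟩)
  exact hp (hpq ▸ hfA B hB)

/-- The members of a family with a common point are otherwise disjoint. -/
theorem card_mul_le_of_forall_mem [Fintype V] (hF : IsOneIntersecting k F) {p : V}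
    (hp : ∀ A ∈ F, p ∈ A) : F.card * (k - 1) + 1 ≤ Fintype.card V := by
  have hdis : (F : Set (Finset V)).PairwiseDisjoint fun A => A.erase p := by
    intro A hA B hB hne
    refine Finset.disjoint_left.2 fun q hqA hqB => ?_
    rw [Finset.mem_erase] at hqA hqB
    exact hqA.1 (Finset.card_le_one.1 (hF.card_inter A hA B hB hne).le q
      (Finset.mem_inter.2 ⟨hqA.2, hqB.2⟩) p (Finset.mem_inter.2 ⟨hp A hA, hp B hB⟩))
  have hcard : (F.biUnion fun A => A.erase p).card = F.card * (k - 1) := by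
    rw [Finset.card_biUnion hdis, Finset.sum_congr rfl fun A hA => by
      rw [Finset.card_erase_of_mem (hp A hA), hF.card_eq A hA], Finset.sum_const, smul_eq_mul]
  have hnot : p ∉ F.biUnion fun A => A.erase p := by simp
  rw [← hcard, ← Finset.card_insert_of_notMem hnot]
  exact Finset.card_le_univ _

/-- A family of `k`-sets pairwise meeting in one point is a sunflower or has at most
`k ^ 2 - k + 1` members. -/
theorem card_le_or [Fintype V] (hF : IsOneIntersecting k F) :
    F.card ≤ k * (k - 1) + 1 ∨ F.card * (k - 1) + 1 ≤ Fintype.card V := by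
  by_cases h : ∃ p, ∀ A ∈ F, p ∈ A
  · obtain ⟨p, hp⟩ := h
    exact Or.inr (hF.card_mul_le_of_forall_mem hp)
  push Not at h
  left
  rcases F.eq_empty_or_nonempty with rfl | ⟨A, hA⟩
  · simp
  have h1 := hF.sum_card_inter hA
  rw [← sum_blockDegree] at h1
  -- With no common point, every point is missed by some member and so has degree at most `k`.
  -- Summing over `A` gives `|F| + k - 1 ≤ k ^ 2`.
  have h2 : ∑ p ∈ A, blockDegree F p ≤ A.card * k := by
    rw [← smul_eq_mul]
    refine Finset.sum_le_card_nsmul _ _ _ fun p _ => ?_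
    obtain ⟨B, hB, hpB⟩ := h p
    exact hF.blockDegree_le hB hpB
  rw [hF.card_eq A hA] at h2
  rcases k with _ | k
  · omega
  · simp only [Nat.add_sub_cancel]
    nlinarith

/-- Two families whose members are mutually disjoint cannot both be large. -/
theorem two_families [Fintype V] {G : Finset (Finset V)} (hF : IsOneIntersecting k F)
    (hG : IsOneIntersecting k G) (hFG : ∀ A ∈ F, ∀ B ∈ G, Disjoint A B) (a b : ℤ) (c : ℤ) :
    0 ≤ a ^ 2 * (F.card * (F.card + k - 1)) + b ^ 2 * (G.card * (G.card + k - 1))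
      - 2 * c * (a * (F.card * k) + b * (G.card * k)) + c ^ 2 * Fintype.card V := by
  have h0 : 0 ≤ ∑ p, (a * blockDegree F p + b * blockDegree G p - c) ^ 2 :=
    Finset.sum_nonneg fun p _ => sq_nonneg _
  have hF1 : (∑ p, (blockDegree F p : ℤ)) = F.card * k := by
    exact_mod_cast hF.sum_blockDegree_univ
  have hG1 : (∑ p, (blockDegree G p : ℤ)) = G.card * k := by
    exact_mod_cast hG.sum_blockDegree_univ
  have hF2 : (∑ p, (blockDegree F p * blockDegree F p : ℤ)) + F.card
      = F.card * (F.card + k) := by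
    exact_mod_cast hF.sum_blockDegree_sq
  have hG2 : (∑ p, (blockDegree G p * blockDegree G p : ℤ)) + G.card
      = G.card * (G.card + k) := by
    exact_mod_cast hG.sum_blockDegree_sq
  -- Disjointness across the families makes the two degree functions orthogonal.
  have hFG0 : (∑ p, (blockDegree F p * blockDegree G p : ℤ)) = 0 := by
    have := sum_blockDegree_mul F G
    rw [Finset.sum_eq_zero fun A hA => Finset.sum_eq_zero fun B hB => by
      rw [Finset.disjoint_iff_inter_eq_empty.1 (hFG A hA B hB), Finset.card_empty]] at this
    exact_mod_cast this
  have hexp : ∑ p, (a * blockDegree F p + b * blockDegree G p - c) ^ 2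
      = a ^ 2 * (∑ p, (blockDegree F p * blockDegree F p : ℤ))
        + b ^ 2 * (∑ p, (blockDegree G p * blockDegree G p : ℤ))
        + 2 * a * b * (∑ p, (blockDegree F p * blockDegree G p : ℤ))
        - 2 * c * (a * (∑ p, (blockDegree F p : ℤ)) + b * (∑ p, (blockDegree G p : ℤ)))
        + c ^ 2 * Fintype.card V := by
    have hc : c ^ 2 * (Fintype.card V : ℤ) = ∑ _p : V, c ^ 2 := by simp [mul_comm]
    rw [hc]
    simp only [Finset.mul_sum, ← Finset.sum_add_distrib, ← Finset.sum_sub_distrib]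
    exact Finset.sum_congr rfl fun p _ => by ring
  rw [hexp, hF1, hG1, hFG0] at h0
  rw [show (F.card * (F.card + k - 1) : ℤ) = F.card * (F.card + k) - F.card by ring, ← hF2,
    show (G.card * (G.card + k - 1) : ℤ) = G.card * (G.card + k) - G.card by ring, ← hG2]
  linarith

end IsOneIntersecting

/-- Two mutually disjoint families of `9`-subsets of a `90`-set, each with all pairwise
intersections of size one, have together at most `76` members. -/
theorem card_add_card_le_of_isOneIntersecting [Fintype V] (hV : Fintype.card V = 90)
    {F G : Finset (Finset V)} (hF : IsOneIntersecting 9 F) (hG : IsOneIntersecting 9 G)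
    (hFG : ∀ A ∈ F, ∀ B ∈ G, Disjoint A B) : F.card + G.card ≤ 76 := by
  have hF1 := hF.card_le_or
  have hG1 := hG.card_le_or
  -- Projecting the constant function 1 onto the two orthogonal degree functions gives the
  -- coefficients `9 / (m + 8)` and `9 / (l + 8)`. Here denominators are cleared.
  have h := hF.two_families hG hFG (9 * (G.card + 8)) (9 * (F.card + 8))
    ((F.card + 8) * (G.card + 8))
  rw [hV] at hF1 hG1 h
  generalize F.card = m at *
  generalize G.card = l at *
  -- `73 = 9 * 8 + 1`; the sunflower case allows only 11 members. A total of at least 77 then leaves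
  -- at least 4 in each family.
  have hm : m ≤ 73 := by omega
  have hl : l ≤ 73 := by omega
  by_contra! hlt
  have hm4 : (4 : ℤ) ≤ m := by omega
  have hl4 : (4 : ℤ) ≤ l := by omega
  have hprod : ((m : ℤ) + 8) * (l + 8) * (9 * (80 + m + l - m * l)) * 8 ≥ 0 := by
    push_cast at h
    nlinarith
  have hpos : (0 : ℤ) < (m + 8) * (l + 8) := by positivity
  have h3 : (m : ℤ) * l - m - l ≤ 80 := by
    by_contra! hgt
    nlinarith
  have : (77 : ℤ) ≤ m + l := by exact_mod_cast hlt
  -- `(m - 4) * (l - 4) ≥ 0` turns `h3` into `3 * (m + l) ≤ 96`.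
  nlinarith [mul_nonneg (sub_nonneg.2 hm4) (sub_nonneg.2 hl4)]

end BlockDegree

/-! ### Characters, Krawtchouk polynomials and the MacWilliams identity. -/

/-- The nontrivial additive character of `ZMod 2`. -/
def signChar (a : ZMod 2) : ℤ := if a = 0 then 1 else -1

theorem signChar_add (a b : ZMod 2) : signChar (a + b) = signChar a * signChar b := by
  revert a b; decide

theorem signChar_sum {ι : Type*} (s : Finset ι) (f : ι → ZMod 2) :
    signChar (∑ i ∈ s, f i) = ∏ i ∈ s, signChar (f i) := by
  classical
  induction s using Finset.induction_on with
  | empty => simp [signChar]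
  | insert a s ha ih => rw [Finset.sum_insert ha, Finset.prod_insert ha, signChar_add, ih]

open Polynomial in
/-- The value at `i` of the binary Krawtchouk polynomial of degree `k` and length `n`. -/
noncomputable def krawtchouk (n k i : ℕ) : ℤ :=
  ((1 - X : ℤ[X]) ^ i * (1 + X) ^ (n - i)).coeff k

open Polynomial in
theorem krawtchouk_eq_sum (n k i : ℕ) : krawtchouk n k i =
    ∑ j ∈ Finset.range (k + 1), (-1) ^ j * (i.choose j : ℤ) * ((n - i).choose (k - j) : ℤ) := by
  have h1 (j : ℕ) : ((1 - X : ℤ[X]) ^ i).coeff j = (-1) ^ j * (i.choose j : ℤ) := by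
    have : ((1 - X : ℤ[X]) ^ i) = ((1 + X) ^ i).comp (C (-1) * X) := by simp [sub_eq_add_neg]
    rw [this, comp_C_mul_X_coeff, coeff_one_add_X_pow, mul_comm]
  rw [krawtchouk, coeff_mul, Finset.Nat.sum_antidiagonal_eq_sum_range_succ_mk]
  refine Finset.sum_congr rfl fun j _ => ?_
  rw [h1, coeff_one_add_X_pow]

section MacWilliams

variable {n : ℕ}

open Polynomial in
-- The summand is a product over coordinates, so the sum factors: a coordinate contributes `1 + X`
-- where `u` vanishes and `1 - X` elsewhere.
theorem sum_signChar_mul_X_pow (u : Fin n → ZMod 2) :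
    ∑ v : Fin n → ZMod 2, C (signChar (u ⬝ᵥ v)) * (X : ℤ[X]) ^ hammingNorm v
      = (1 - X) ^ hammingNorm u * (1 + X) ^ (n - hammingNorm u) := by
  have hterm (v : Fin n → ZMod 2) : C (signChar (u ⬝ᵥ v)) * (X : ℤ[X]) ^ hammingNorm v
      = ∏ i, C (signChar (u i * v i)) * (X : ℤ[X]) ^ (if v i ≠ 0 then 1 else 0) := by
    rw [dotProduct, signChar_sum, hammingNorm, Finset.card_filter, ← Finset.prod_pow_eq_pow_sum,
      map_prod, Finset.prod_mul_distrib]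
  have hfac (a : ZMod 2) : ∑ b : ZMod 2, C (signChar (a * b)) * (X : ℤ[X]) ^
      (if b ≠ 0 then 1 else 0) = if a ≠ 0 then 1 - X else 1 + X := by
    rw [show (Finset.univ : Finset (ZMod 2)) = {0, 1} from rfl, Finset.sum_pair (by decide)]
    by_cases ha : a = 0 <;> simp [ha, signChar, sub_eq_add_neg]
  simp only [hterm]
  rw [← Fintype.piFinset_univ, ← Finset.prod_univ_sum (fun _ => Finset.univ)
    (fun i b => C (signChar (u i * b)) * (X : ℤ[X]) ^ (if b ≠ 0 then 1 else 0))]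
  simp only [hfac]
  rw [Finset.prod_ite, Finset.prod_const, Finset.prod_const, hammingNorm]
  congr 2
  have := Finset.card_filter_add_card_filter_not (s := (Finset.univ : Finset (Fin n)))
    (fun i => u i ≠ 0)
  rw [Finset.card_univ, Fintype.card_fin] at this
  omega

theorem sum_signChar_of_hammingNorm_eq (u : Fin n → ZMod 2) (k : ℕ) :
    ∑ v : Fin n → ZMod 2 with hammingNorm v = k, signChar (u ⬝ᵥ v)
      = krawtchouk n k (hammingNorm u) := by
  rw [krawtchouk, ← sum_signChar_mul_X_pow, Polynomial.finsetSum_coeff, Finset.sum_filter]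
  refine Finset.sum_congr rfl fun v _ => ?_
  rw [Polynomial.coeff_C_mul, Polynomial.coeff_X_pow]
  by_cases h : hammingNorm v = k
  · simp [h]
  · simp [h, Ne.symm h]

open Classical in
theorem weightCount_eq_card (s : Set (Fin n → ZMod 2)) (i : ℕ) :
    weightCount s i = (Finset.univ.filter fun x => x ∈ s ∧ hammingNorm x = i).card := by
  rw [weightCount, ← Set.ncard_coe_finset]
  congr 1
  ext x
  simp

open Classical in
-- Orthogonality of characters: if `v` is not orthogonal to some `u₀ ∈ D`, translation by `u₀`
-- permutes `D` and negates the sum.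
theorem sum_signChar_submodule (D : Submodule (ZMod 2) (Fin n → ZMod 2)) (v : Fin n → ZMod 2) :
    ∑ u with u ∈ D, signChar (u ⬝ᵥ v) =
      if v ∈ dualCode (D : Set (Fin n → ZMod 2))
        then ((Finset.univ.filter (· ∈ D)).card : ℤ) else 0 := by
  split_ifs with hv
  · rw [Finset.sum_congr rfl fun u hu => ?_, Finset.sum_const, nsmul_one]
    rw [dotProduct_comm, hv u (Finset.mem_filter.1 hu).2, signChar, if_pos rfl]
  · have : ∃ u₀ ∈ D, v ⬝ᵥ u₀ ≠ 0 := by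
      by_contra! h
      exact hv h
    obtain ⟨u₀, hu₀, hne⟩ := this
    have hs : signChar (u₀ ⬝ᵥ v) = -1 := by
      rw [dotProduct_comm, signChar, if_neg hne]
    have hkey : ∑ u with u ∈ D, signChar (u ⬝ᵥ v)
        = ∑ u with u ∈ D, signChar ((u + u₀) ⬝ᵥ v) := by
      refine (Finset.sum_equiv (Equiv.addRight u₀) (fun u => ?_) fun u _ => rfl).symm
      simp [D.add_mem_iff_left hu₀]
    simp only [add_dotProduct, signChar_add, hs, ← Finset.sum_mul] at hkey
    linarith

open Classical in
theorem sum_weightCount_mul (s : Set (Fin n → ZMod 2)) (f : ℕ → ℤ) :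
    ∑ i ∈ Finset.range (n + 1), (weightCount s i : ℤ) * f i
      = ∑ u with u ∈ s, f (hammingNorm u) := by
  have hmaps : ∀ u ∈ Finset.univ.filter (· ∈ s), hammingNorm u ∈ Finset.range (n + 1) := by
    intro u _
    have := hammingNorm_le_card_fintype (x := u)
    rw [Fintype.card_fin] at this
    rw [Finset.mem_range]; omega
  rw [← Finset.sum_fiberwise_of_maps_to hmaps]
  refine Finset.sum_congr rfl fun i _ => ?_
  rw [weightCount_eq_card, Finset.filter_filter,
    Finset.sum_congr rfl fun u hu => by rw [(Finset.mem_filter.1 hu).2.2], Finset.sum_const,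
    nsmul_eq_mul]

/-- The MacWilliams identity for binary codes. -/
theorem macWilliams (D : Submodule (ZMod 2) (Fin n → ZMod 2)) (k : ℕ) :
    (∑ i ∈ Finset.range (n + 1), (weightCount (D : Set (Fin n → ZMod 2)) i : ℤ))
        * weightCount (dualCode (D : Set (Fin n → ZMod 2)) : Set (Fin n → ZMod 2)) k
      = ∑ i ∈ Finset.range (n + 1),
        (weightCount (D : Set (Fin n → ZMod 2)) i : ℤ) * krawtchouk n k i := by
  classical
  have h1 := sum_weightCount_mul (D : Set (Fin n → ZMod 2)) fun _ => 1
  simp only [mul_one, SetLike.mem_coe, Finset.sum_const, nsmul_eq_mul] at h1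
  rw [h1, sum_weightCount_mul]
  simp only [SetLike.mem_coe, ← sum_signChar_of_hammingNorm_eq]
  rw [Finset.sum_comm]
  simp only [sum_signChar_submodule]
  rw [← Finset.sum_filter, Finset.filter_filter, Finset.sum_const, nsmul_eq_mul,
    weightCount_eq_card, mul_comm]
  simp only [SetLike.mem_coe, and_comm]

theorem coeff_weightEnumerator (s : Set (Fin n → ZMod 2)) {i : ℕ} (hi : i < n + 1) :
    (weightEnumerator s).coeff i = weightCount s i := by
  simp [weightEnumerator, hi]

end MacWilliams

/-! ### Numerical evaluation of the doubly even part of `W90`. -/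

set_option maxRecDepth 4000 in
theorem sum_range_ite_mod_four (f g : ℕ → ℤ) :
    ∑ i ∈ Finset.range 91, (if i % 4 = 0 then f i else 0) * g i
      = ∑ j ∈ Finset.range 23, f (4 * j) * g (4 * j) := by
  simp [Finset.sum_range_succ]


-- This sum is the size of `C₀`; the parameters `α` and `β` cancel.
set_option maxRecDepth 8000 in
theorem sum_coeff_W90 (α β : ℤ) :
    ∑ i ∈ Finset.range 91, (if i % 4 = 0 then (W90 α β).coeff i else 0) = 2 ^ 44 := by
  have := sum_range_ite_mod_four (W90 α β).coeff fun _ => 1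
  simp only [mul_one] at this
  rw [this]
  unfold W90
  simp only [Polynomial.coeff_add,
    Polynomial.coeff_C_mul, Polynomial.coeff_X_pow, Polynomial.coeff_one]
  simp only [Finset.sum_range_succ, Finset.sum_range_zero]
  norm_num
  ring

-- The right side of the MacWilliams identity for `C₀` in degree 9: `β` and the constant term
-- cancel.
set_option maxRecDepth 8000 in
theorem sum_coeff_W90_mul_krawtchouk (α β : ℤ) :
    ∑ i ∈ Finset.range 91, (if i % 4 = 0 then (W90 α β).coeff i else 0) * krawtchouk 90 9 i
      = 2 ^ 44 * α := by
  rw [sum_range_ite_mod_four]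
  unfold W90
  simp only [Polynomial.coeff_add,
    Polynomial.coeff_C_mul, Polynomial.coeff_X_pow, Polynomial.coeff_one]
  simp only [Finset.sum_range_succ, Finset.sum_range_zero]
  norm_num
  have hk (i : ℕ) := krawtchouk_eq_sum 90 9 i
  simp only [Finset.sum_range_succ, Finset.sum_range_zero] at hk
  simp only [hk]
  norm_num [Nat.choose_eq_descFactorial_div_factorial, Nat.descFactorial, Nat.factorial]
  ring

/-! ### Supports, weights and inner products. -/

section Weight

variable {n : ℕ}

/-- The set of nonzero coordinates of a binary vector. -/
def vectorSupport (x : Fin n → ZMod 2) : Finset (Fin n) :=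
  Finset.univ.filter fun i => x i ≠ 0

theorem card_vectorSupport (x : Fin n → ZMod 2) : (vectorSupport x).card = hammingNorm x := rfl

theorem mem_vectorSupport {x : Fin n → ZMod 2} {i : Fin n} : i ∈ vectorSupport x ↔ x i ≠ 0 := by
  simp [vectorSupport]

theorem vectorSupport_injective : Function.Injective (vectorSupport (n := n)) := by
  intro x y h
  funext i
  have hi : x i ≠ 0 ↔ y i ≠ 0 := by rw [← mem_vectorSupport, h, mem_vectorSupport]
  generalize x i = a at hi
  generalize y i = b at hi
  revert a b
  decide

theorem dotProduct_eq_card_inter (x y : Fin n → ZMod 2) :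
    x ⬝ᵥ y = ((vectorSupport x ∩ vectorSupport y).card : ZMod 2) := by
  rw [vectorSupport, vectorSupport, ← Finset.filter_and, Finset.card_filter, Nat.cast_sum,
    dotProduct]
  refine Finset.sum_congr rfl fun i _ => ?_
  generalize x i = a
  generalize y i = b
  revert a b
  decide

theorem dotProduct_eq_zero_iff_even (x y : Fin n → ZMod 2) :
    x ⬝ᵥ y = 0 ↔ Even (vectorSupport x ∩ vectorSupport y).card := by
  rw [dotProduct_eq_card_inter, ZMod.natCast_eq_zero_iff_even]

theorem hammingNorm_add_add (x y : Fin n → ZMod 2) :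
    hammingNorm (x + y) + 2 * (vectorSupport x ∩ vectorSupport y).card
      = hammingNorm x + hammingNorm y := by
  simp only [hammingNorm, vectorSupport, ← Finset.filter_and, Finset.card_filter, Finset.mul_sum,
    ← Finset.sum_add_distrib]
  refine Finset.sum_congr rfl fun i _ => ?_
  have key : ∀ a b : ZMod 2, (if a + b ≠ 0 then 1 else 0) + 2 * (if a ≠ 0 ∧ b ≠ 0 then 1 else 0)
      = (if a ≠ 0 then 1 else 0) + if b ≠ 0 then 1 else 0 := by decide
  exact key (x i) (y i)

end Weight

/-! ### The doubly even subcode and the shadow of a self-dual code. -/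

section Shadow

variable {n : ℕ} {C : Submodule (ZMod 2) (Fin n → ZMod 2)}

theorem IsSelfDual.mem_iff (hC : IsSelfDual C) {x : Fin n → ZMod 2} :
    x ∈ C ↔ ∀ y ∈ C, x ⬝ᵥ y = 0 := by
  constructor
  · intro hx
    rw [hC] at hx
    exact hx
  · intro h
    rw [hC]
    exact h

theorem IsSelfDual.even_card_inter (hC : IsSelfDual C) {x y : Fin n → ZMod 2} (hx : x ∈ C)
    (hy : y ∈ C) : Even (vectorSupport x ∩ vectorSupport y).card :=
  (dotProduct_eq_zero_iff_even x y).1 (hC.mem_iff.1 hx y hy)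

theorem IsSelfDual.even_hammingNorm (hC : IsSelfDual C) {x : Fin n → ZMod 2} (hx : x ∈ C) :
    Even (hammingNorm x) := by
  simpa [card_vectorSupport] using hC.even_card_inter hx hx

/-- The doubly even part of a self-dual code, as a subspace. -/
def IsSelfDual.doublyEvenSubcode (hC : IsSelfDual C) : Submodule (ZMod 2) (Fin n → ZMod 2) where
  carrier := doublyEvenPart C
  zero_mem' := ⟨C.zero_mem, by rw [hammingNorm_zero]⟩
  add_mem' := by
    rintro x y ⟨hx, hx4⟩ ⟨hy, hy4⟩
    refine ⟨C.add_mem hx hy, ?_⟩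
    have h := hammingNorm_add_add x y
    obtain ⟨t, ht⟩ := hC.even_card_inter hx hy
    simp only [Nat.ModEq] at *
    omega
  smul_mem' := by
    rintro c x ⟨hx, hx4⟩
    refine ⟨C.smul_mem c hx, ?_⟩
    have hc : c = 0 ∨ c = 1 := by revert c; decide
    rcases hc with rfl | rfl
    · rw [zero_smul, hammingNorm_zero]
    · rwa [one_smul]

theorem IsSelfDual.coe_doublyEvenSubcode (hC : IsSelfDual C) :
    (hC.doublyEvenSubcode : Set (Fin n → ZMod 2)) = doublyEvenPart C := rfl

/-- The sum of two codewords outside the doubly even part lies in it. -/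
theorem IsSelfDual.add_mem_doublyEvenPart (hC : IsSelfDual C) {x y : Fin n → ZMod 2} (hx : x ∈ C)
    (hx0 : x ∉ doublyEvenPart C) (hy : y ∈ C) (hy0 : y ∉ doublyEvenPart C) :
    x + y ∈ doublyEvenPart C := by
  refine ⟨C.add_mem hx hy, ?_⟩
  have hx2 : ¬ hammingNorm x ≡ 0 [MOD 4] := fun h => hx0 ⟨hx, h⟩
  have hy2 : ¬ hammingNorm y ≡ 0 [MOD 4] := fun h => hy0 ⟨hy, h⟩
  have h := hammingNorm_add_add x y
  obtain ⟨t, ht⟩ := hC.even_card_inter hx hy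
  obtain ⟨a, ha⟩ := hC.even_hammingNorm hx
  obtain ⟨b, hb⟩ := hC.even_hammingNorm hy
  simp only [Nat.ModEq] at *
  omega

/-- `C₀` together with any one codeword outside it spans `C`. Were `v` also orthogonal to `x`, it
would be orthogonal to all of `C`, hence lie in `C`. -/
theorem IsSelfDual.dotProduct_eq_one_of_mem_shadow (hC : IsSelfDual C) {v x : Fin n → ZMod 2}
    (hv : v ∈ shadow C) (hx : x ∈ C) (hx0 : x ∉ doublyEvenPart C) : v ⬝ᵥ x = 1 := by
  obtain ⟨hvd, hvC⟩ := hv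
  by_contra hne
  have hz : v ⬝ᵥ x = 0 := by
    generalize v ⬝ᵥ x = a at hne
    revert a
    decide
  refine hvC (hC.mem_iff.2 fun y hy => ?_)
  by_cases hy0 : y ∈ doublyEvenPart C
  · exact hvd y hy0
  · have := hvd _ (hC.add_mem_doublyEvenPart hx hx0 hy hy0)
    rwa [dotProduct_add, hz, zero_add] at this

/-- The sum of two shadow vectors is a codeword. -/
theorem IsSelfDual.add_mem_of_mem_shadow (hC : IsSelfDual C) {u v : Fin n → ZMod 2}
    (hu : u ∈ shadow C) (hv : v ∈ shadow C) : u + v ∈ C := by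
  refine hC.mem_iff.2 fun y hy => ?_
  rw [add_dotProduct]
  by_cases hy0 : y ∈ doublyEvenPart C
  · rw [hu.1 y hy0, hv.1 y hy0, add_zero]
  · rw [hC.dotProduct_eq_one_of_mem_shadow hu hy hy0, hC.dotProduct_eq_one_of_mem_shadow hv hy hy0]
    decide

theorem minWeight_le {x : Fin n → ZMod 2} (hx : x ∈ C) (h0 : x ≠ 0) :
    minWeight C ≤ hammingNorm x :=
  Nat.sInf_le ⟨x, hx, h0, rfl⟩

theorem exists_finset_card_eq_weightCount (s : Set (Fin n → ZMod 2)) (i : ℕ) :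
    ∃ T : Finset (Fin n → ZMod 2), T.card = weightCount s i ∧
      ∀ {x}, x ∈ T → x ∈ s ∧ hammingNorm x = i := by
  classical
  exact ⟨_, (weightCount_eq_card s i).symm, fun hx => (Finset.mem_filter.1 hx).2⟩

end Shadow

/-! ### The upper bound for weight 9 vectors in the shadow. -/

/-- The shadow of a self-dual `[90, 45, 16]` code has at most `76`
vectors of weight `9`. -/
theorem weightCount_shadow_le {C : Submodule (ZMod 2) (Fin 90 → ZMod 2)} (hC : IsSelfDual C)
    (hmin : minWeight C = 16) : weightCount (shadow C) 9 ≤ 76 := by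
  classical
  obtain ⟨T, hTcard, hTmem⟩ := exists_finset_card_eq_weightCount (shadow C) 9
  rw [← hTcard]
  rcases T.eq_empty_or_nonempty with h | ⟨u₀, hu₀⟩
  · rw [h]; simp
  -- The nonzero codeword `u + v` has weight 18 or 16, for supports meeting in 0 or 1 points; only
  -- 16 is divisible by 4.
  have hinter {u v} (hu : u ∈ T) (hv : v ∈ T) (hne : u ≠ v) :
      (vectorSupport u ∩ vectorSupport v).card ≤ 1 ∧
      (u + v ∈ doublyEvenPart C ↔ (vectorSupport u ∩ vectorSupport v).card = 1) := by
    have hmem := hC.add_mem_of_mem_shadow (hTmem hu).1 (hTmem hv).1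
    have h16 := minWeight_le hmem fun h => hne (by
      rw [← sub_eq_zero, sub_eq_add_neg, ZModModule.neg_eq_self, h])
    have h := hammingNorm_add_add u v
    rw [(hTmem hu).2, (hTmem hv).2] at h
    rw [hmin] at h16
    have hiff : u + v ∈ doublyEvenPart C ↔ hammingNorm (u + v) ≡ 0 [MOD 4] :=
      ⟨fun h => h.2, fun h => ⟨hmem, h⟩⟩
    rw [hiff, Nat.ModEq]
    omega
  have hadd (u v : Fin 90 → ZMod 2) : u + v = (u₀ + u) + (u₀ + v) := by
    rw [add_add_add_comm, ZModModule.add_self, zero_add]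
  have hinj (s : Finset (Fin 90 → ZMod 2)) : (s.image vectorSupport).card = s.card :=
    Finset.card_image_of_injective s vectorSupport_injective
  have hone (s : Finset (Fin 90 → ZMod 2)) (hs : s ⊆ T)
      (hs2 : ∀ u ∈ s, ∀ v ∈ s, u + v ∈ doublyEvenPart C) :
      IsOneIntersecting 9 (s.image vectorSupport) := by
    constructor
    · intro A hA
      obtain ⟨u, hu, rfl⟩ := Finset.mem_image.1 hA
      exact (hTmem (hs hu)).2
    · intro A hA B hB hne
      obtain ⟨u, hu, rfl⟩ := Finset.mem_image.1 hA
      obtain ⟨v, hv, rfl⟩ := Finset.mem_image.1 hB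
      exact (hinter (hs hu) (hs hv) (fun h => hne (h ▸ rfl))).2.1 (hs2 u hu v hv)
  have hmemC {u} (hu : u ∈ T) : u₀ + u ∈ C :=
    hC.add_mem_of_mem_shadow (hTmem hu₀).1 (hTmem hu).1
  -- The two families are the cosets of `C₀` in the shadow, told apart by comparison with `u₀`.
  rw [← Finset.card_filter_add_card_filter_not (s := T) (fun u => u₀ + u ∈ doublyEvenPart C),
    ← hinj, ← hinj (T.filter fun u => ¬ _)]
  refine card_add_card_le_of_isOneIntersecting (Fintype.card_fin 90)
    (hone _ (Finset.filter_subset _ _) ?_) (hone _ (Finset.filter_subset _ _) ?_) ?_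
  · intro u hu v hv
    rw [hadd]
    exact hC.doublyEvenSubcode.add_mem (Finset.mem_filter.1 hu).2 (Finset.mem_filter.1 hv).2
  · intro u hu v hv
    rw [Finset.mem_filter] at hu hv
    rw [hadd]
    exact hC.add_mem_doublyEvenPart (hmemC hu.1) hu.2 (hmemC hv.1) hv.2
  · intro A hA B hB
    obtain ⟨u, hu, rfl⟩ := Finset.mem_image.1 hA
    obtain ⟨v, hv, rfl⟩ := Finset.mem_image.1 hB
    rw [Finset.mem_filter] at hu hv
    obtain ⟨hle, hiff⟩ := hinter hu.1 hv.1 (by rintro rfl; exact hv.2 hu.2)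
    rw [Finset.disjoint_iff_inter_eq_empty, ← Finset.card_eq_zero]
    have hnot : u + v ∉ doublyEvenPart C := fun h => hv.2 (by
      have h' : u₀ + v = (u₀ + u) + (u + v) := by
        rw [add_assoc, ← add_assoc u, ZModModule.add_self, zero_add]
      rw [h']
      exact hC.doublyEvenSubcode.add_mem hu.2 h)
    rw [hiff] at hnot
    omega

/-! ### Identification of `α` and conclusion. -/

theorem weightCount_doublyEvenPart {n : ℕ} (C : Submodule (ZMod 2) (Fin n → ZMod 2)) (i : ℕ) :
    weightCount (doublyEvenPart C) i =
      if i % 4 = 0 then weightCount (C : Set (Fin n → ZMod 2)) i else 0 := by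
  split_ifs with h
  · rw [weightCount, weightCount]
    congr 1
    ext x
    constructor
    · rintro ⟨hx, hi⟩
      exact ⟨hx.1, hi⟩
    · rintro ⟨hx, hi⟩
      exact ⟨⟨hx, hi ▸ h⟩, hi⟩
  · rw [weightCount, Set.ncard_eq_zero]
    ext x
    simp only [Set.mem_ofPred_eq, Set.mem_empty_iff_false, iff_false]
    rintro ⟨hx, hi⟩
    exact h (hi ▸ hx.2)

theorem weightCount_shadow_eq {C : Submodule (ZMod 2) (Fin 90 → ZMod 2)} {α β : ℤ}
    (hC : IsSelfDual C) (hmin : minWeight C = 16)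
    (hW : weightEnumerator (C : Set (Fin 90 → ZMod 2)) = W90 α β) :
    (weightCount (shadow C) 9 : ℤ) = α := by
  have hcount : ∀ i ∈ Finset.range (90 + 1),
      (weightCount (hC.doublyEvenSubcode : Set (Fin 90 → ZMod 2)) i : ℤ)
        = if i % 4 = 0 then (W90 α β).coeff i else 0 := by
    intro i hi
    rw [hC.coe_doublyEvenSubcode, weightCount_doublyEvenPart, ← hW,
      coeff_weightEnumerator _ (Finset.mem_range.1 hi)]
    split_ifs <;> simp
  have hmac := macWilliams hC.doublyEvenSubcode 9
  rw [Finset.sum_congr rfl hcount, Finset.sum_congr rfl fun i hi =>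
    congrArg (· * krawtchouk 90 9 i) (hcount i hi), sum_coeff_W90, sum_coeff_W90_mul_krawtchouk] at hmac
  have hdual := mul_left_cancel₀ (by norm_num) hmac
  rw [← hdual, weightCount, weightCount]
  congr 2
  -- `C₀^⊥` and the shadow differ only by codewords of `C`, and none of those has weight 9, since `9
  -- < 16`.
  ext x
  constructor
  · rintro ⟨hx, h9⟩
    exact ⟨hx.1, h9⟩
  · rintro ⟨hx, h9⟩
    refine ⟨⟨hx, fun hxC => ?_⟩, h9⟩
    have := minWeight_le (C := C) hxC (by rintro rfl; simp at h9)
    omega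

theorem mainTheorem5 (C : Submodule (ZMod 2) (Fin 90 → ZMod 2)) (α β : ℤ)
    (hcode : IsCode 90 45 16 C) (hext : IsExtremal C) (hse : IsSinglyEven C)
    (hW : weightEnumerator (C : Set (Fin 90 → ZMod 2)) = W90 α β) :
    (weightCount (shadow C) 9 : ℤ) = α ∧ 0 ≤ α ∧ α ≤ 76 := by
  have h := weightCount_shadow_eq hext.1 hcode.2 hW
  have h76 := weightCount_shadow_le hext.1 hcode.2
  omega
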